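/- Given a real base $q>1$, a $q$-expansion of a real number $x$ is a sequence $(d_i)_{i\ge 1}$ with $d_i\in\{0,1,q\}$ for all $i$ and $x=\sum_{i=1}^\infty d_i q^{-i}$. Let $E_q$ be the set of all $x$ that have a $q$-expansion. For $\kappa\in\{\aleph_0,2^{\aleph_0}\}$ let $\mathcal U_q^{(\kappa)}$ be the set of all $x\in E_q$ whose set of $q$-expansions has cardinality exactly $\kappa$, and let $\mathcal B_{\aleph_0}$ be the set of all $q>1$ with $\mathcal U_q^{(\aleph_0)}\neq\emptyset$. Let $q_c\approx 2.32472$ be the unique real root of $x^3-3x^2+2x-1=0$, and let $q^*=(3+\sqrt5)/2$. Then: (i) for every $q\in\mathcal B_{\aleph_0}\setminus(q_c,q^*)$, the set $\mathcal U_q^{(\aleph_0)}$ is countably infinite; (ii) for every $q>1$, the set $\mathcal U_q^{(2^{\aleph_0})}$ has full Hausdorff dimension in $E_q$, i.e. $\dim_H \mathcal U_q^{(2^{\aleph_0})}=\dim_H E_q$. -/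

import Mathlib

open scoped Cardinal

namespace QExpansion

/-- The set of all expansions of `x` in base `q` over the alphabet `{0, 1, q}`. The digit `d i`
has weight `q ^ (-(i + 1))`, because sequences are indexed from `0`. -/
def expansions (q x : ℝ) : Set (ℕ → ℝ) :=
  {d | (∀ i, d i ∈ ({0, 1, q} : Set ℝ)) ∧ HasSum (fun i => d i / q ^ (i + 1)) x}

/-- The set `E_q` of all real numbers that have an expansion in base `q`. -/
def E (q : ℝ) : Set ℝ := {x | (expansions q x).Nonempty}

/-- The set `U_q^(κ)` of all points of `E_q` that have exactly `κ` different expansions. -/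
def U (q : ℝ) (κ : Cardinal.{0}) : Set ℝ := {x ∈ E q | #(expansions q x) = κ}

/-- The set `B_κ` of all bases `q > 1` for which some point has exactly `κ` different
expansions. -/
def B (κ : Cardinal.{0}) : Set ℝ := {q | 1 < q ∧ ∃ x ∈ E q, #(expansions q x) = κ}

theorem existsUnique_root : ∃! x : ℝ, x ^ 3 - 3 * x ^ 2 + 2 * x - 1 = 0 := by
  have hc : ContinuousOn (fun x : ℝ => x ^ 3 - 3 * x ^ 2 + 2 * x - 1) (Set.Icc 2 3) := by
    fun_prop
  have h0 : (0 : ℝ) ∈ Set.Icc ((2 : ℝ) ^ 3 - 3 * 2 ^ 2 + 2 * 2 - 1)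
      ((3 : ℝ) ^ 3 - 3 * 3 ^ 2 + 2 * 3 - 1) := by norm_num
  obtain ⟨x, hx, hx0⟩ := intermediate_value_Icc (by norm_num : (2 : ℝ) ≤ 3) hc h0
  have hroot : ∀ y : ℝ, y ^ 3 - 3 * y ^ 2 + 2 * y - 1 = 0 → 2 < y := by
    intro y hy
    by_contra! h
    rcases le_total y 0 with h' | h'
    · nlinarith [mul_nonneg (neg_nonneg.2 h') (sq_nonneg y), sq_nonneg y]
    · nlinarith [mul_nonneg h' (sq_nonneg (y - 1)), mul_nonneg h' (sub_nonneg.2 h),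
        mul_nonneg (mul_nonneg h' (sub_nonneg.2 h)) (sub_nonneg.2 h), sq_nonneg (y - 1),
        mul_nonneg h' (sq_nonneg (3 * y - 1)), sq_nonneg (3 * y - 1)]
  refine ⟨x, hx0, fun y hy => ?_⟩
  have h1 := hroot x hx0
  have h2 := hroot y hy
  have hfac : (y - x) * (y ^ 2 + x * y + x ^ 2 - 3 * (x + y) + 2) = 0 := by
    simp only at hx0
    linear_combination hy - hx0
  rcases mul_eq_zero.1 hfac with h | h
  · linarith
  · nlinarith [mul_pos (sub_pos.2 h1) (sub_pos.2 h2), sq_nonneg (x - 2), sq_nonneg (y - 2)]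

/-- The constant `q_c ≈ 2.32472`: the unique real root of `x ^ 3 - 3 * x ^ 2 + 2 * x - 1`. -/
noncomputable def qc : ℝ := existsUnique_root.choose

theorem qc_spec : qc ^ 3 - 3 * qc ^ 2 + 2 * qc - 1 = 0 := existsUnique_root.choose_spec.1

/-- The constant `q^* = (3 + √5) / 2`. -/
noncomputable def qstar : ℝ := (3 + √5) / 2

end QExpansion

/-! The expansions of `x` form a closed set in the compact space of letter sequences. A nonempty
countable closed set has an isolated point, and beyond its isolating prefix that point is the only
expansion of its own value. So every point with countably many expansions is the image, under one of
countably many Lipschitz maps `wordMap q l`, of the value of a univoque sequence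
(`exists_wordMap_univoque`). All other points of `E q` have `2 ^ ℵ₀` expansions.

For (ii) it therefore suffices that values of univoque sequences have smaller dimension than `E q`.
Since 0/q + q/q² = 1/q + 0/q², a univoque sequence avoids the words 02 and 10, and this subshift has
growth rate `qc`; this bounds the dimension by log qc / log q. For `q ≤ qc` only the constants 0 and
2 are univoque. On the other side `E q` is an interval for `q ≤ qstar`, and for larger `q` it maps
onto `E qstar` by a Hölder map of exponent log qstar / log q. As `qc < qstar`, the inequality is
strict.

For (i), countability for `q ≤ qc` follows from the two univoque sequences. For `q ≥ qstar`, apart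
from expansions with a constant tail, coincidences come from exchanging 02 and 10. A point with
infinitely many expansions, none with a constant tail, has an expansion containing infinitely many
exchangeable blocks, hence uncountably many expansions. Infinitude comes from moving a point
repeatedly towards 0 or `top q`, where no new first digit becomes possible; bases below 2 do not
occur. -/

namespace QExpansion

open Set Filter Topology
open scoped NNReal ENNReal MeasureTheory

/-! ### Sequences over a three-letter alphabet and their values -/

/-- The digits `0`, `1`, `q` of base `q`. -/
def digit (q : ℝ) : Fin 3 → ℝ := ![0, 1, q]

@[simp] theorem digit_zero (q : ℝ) : digit q 0 = 0 := rfl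
@[simp] theorem digit_one (q : ℝ) : digit q 1 = 1 := rfl
@[simp] theorem digit_two (q : ℝ) : digit q 2 = q := rfl

theorem fin_three_cases (a : Fin 3) : a = 0 ∨ a = 1 ∨ a = 2 := by
  revert a; decide

theorem digit_nonneg {q : ℝ} (hq : 1 < q) (a : Fin 3) : 0 ≤ digit q a := by
  rcases fin_three_cases a with rfl | rfl | rfl <;> simp <;> linarith

theorem digit_le {q : ℝ} (hq : 1 < q) (a : Fin 3) : digit q a ≤ q := by
  rcases fin_three_cases a with rfl | rfl | rfl <;> simp <;> linarith

theorem digit_injective {q : ℝ} (hq : 1 < q) : Function.Injective (digit q) := by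
  intro a b h
  rcases fin_three_cases a with rfl | rfl | rfl <;>
    rcases fin_three_cases b with rfl | rfl | rfl <;> simp at h ⊢ <;> linarith

/-- The value in base `q` of a digit sequence. -/
noncomputable def value (q : ℝ) (d : ℕ → Fin 3) : ℝ := ∑' i, digit q (d i) / q ^ (i + 1)

/-- The largest point of `E q`. -/
noncomputable def top (q : ℝ) : ℝ := q / (q - 1)

/-- The sequence `d` without its first `n` letters. -/
def tail (n : ℕ) (d : ℕ → Fin 3) : ℕ → Fin 3 := fun i => d (i + n)

/-- The sequence `d` with the letter `a` put in front. -/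
def prepend (a : Fin 3) (d : ℕ → Fin 3) : ℕ → Fin 3
  | 0 => a
  | n + 1 => d n

/-- The first `n` letters of `d`, followed by `e`. -/
def splice (n : ℕ) (d e : ℕ → Fin 3) : ℕ → Fin 3 := fun i => if i < n then d i else e (i - n)

@[simp] theorem tail_apply (n : ℕ) (d : ℕ → Fin 3) (i : ℕ) : tail n d i = d (i + n) := rfl
@[simp] theorem tail_zero (d : ℕ → Fin 3) : tail 0 d = d := rfl
@[simp] theorem prepend_zero (a : Fin 3) (d : ℕ → Fin 3) : prepend a d 0 = a := rfl
@[simp] theorem tail_one_prepend (a : Fin 3) (d : ℕ → Fin 3) : tail 1 (prepend a d) = d := rfl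

theorem tail_tail (m n : ℕ) (d : ℕ → Fin 3) : tail m (tail n d) = tail (n + m) d := by
  funext i; simp [tail, add_assoc, add_comm m]

theorem prepend_tail (d : ℕ → Fin 3) : prepend (d 0) (tail 1 d) = d := by
  funext i; cases i <;> rfl

theorem prepend_injective (a : Fin 3) : Function.Injective (prepend a) := fun d e h => by
  simpa using congrArg (tail 1) h

theorem splice_of_lt {n i : ℕ} (h : i < n) (d e : ℕ → Fin 3) : splice n d e i = d i := if_pos h

@[simp] theorem tail_splice (n : ℕ) (d e : ℕ → Fin 3) : tail n (splice n d e) = e := by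
  funext i; simp [splice]

theorem summable_bound {q : ℝ} (hq : 1 < q) : HasSum (fun i : ℕ => q / q ^ (i + 1)) (top q) := by
  have h := hasSum_geometric_of_lt_one (r := q⁻¹) (by positivity) (inv_lt_one_of_one_lt₀ hq)
  have h1 : (1 - q⁻¹)⁻¹ = top q := by
    rw [top]; field_simp
  rw [h1] at h
  convert h using 2 with i
  rw [pow_succ, inv_pow]; field_simp

theorem term_nonneg {q : ℝ} (hq : 1 < q) (d : ℕ → Fin 3) (i : ℕ) :
    0 ≤ digit q (d i) / q ^ (i + 1) :=
  div_nonneg (digit_nonneg hq _) (by positivity)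

theorem term_le {q : ℝ} (hq : 1 < q) (d : ℕ → Fin 3) (i : ℕ) :
    digit q (d i) / q ^ (i + 1) ≤ q / q ^ (i + 1) :=
  div_le_div_of_nonneg_right (digit_le hq _) (by positivity)

theorem hasSum_value {q : ℝ} (hq : 1 < q) (d : ℕ → Fin 3) :
    HasSum (fun i => digit q (d i) / q ^ (i + 1)) (value q d) :=
  (Summable.of_nonneg_of_le (term_nonneg hq d) (term_le hq d) (summable_bound hq).summable).hasSum

theorem value_nonneg {q : ℝ} (hq : 1 < q) (d : ℕ → Fin 3) : 0 ≤ value q d :=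
  tsum_nonneg (term_nonneg hq d)

theorem value_le_top {q : ℝ} (hq : 1 < q) (d : ℕ → Fin 3) : value q d ≤ top q :=
  hasSum_le (term_le hq d) (hasSum_value hq d) (summable_bound hq)

theorem top_pos {q : ℝ} (hq : 1 < q) : 0 < top q := div_pos (by linarith) (by linarith)

theorem mul_top {q : ℝ} (hq : 1 < q) : q * top q = q + top q := by
  have : q - 1 ≠ 0 := by linarith
  rw [top]; field_simp; ring

theorem mul_value {q : ℝ} (hq : 1 < q) (d : ℕ → Fin 3) :
    q * value q d = digit q (d 0) + value q (tail 1 d) := by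
  have h0 : q ≠ 0 := by positivity
  have h := (hasSum_value hq d).summable.tsum_eq_zero_add
  have h2 : ∀ i, digit q (d (i + 1)) / q ^ (i + 1 + 1) =
      q⁻¹ * (digit q (tail 1 d i) / q ^ (i + 1)) := fun i => by
    rw [pow_succ q (i + 1), tail_apply]; field_simp
  simp_rw [h2, tsum_mul_left] at h
  rw [value, h, value, zero_add, pow_one]; field_simp

theorem value_prepend {q : ℝ} (hq : 1 < q) (a : Fin 3) (d : ℕ → Fin 3) :
    q * value q (prepend a d) = digit q a + value q d := by
  rw [mul_value hq]; rfl

theorem value_eq_of_tail {q : ℝ} (hq : 1 < q) {d e : ℕ → Fin 3} (h0 : d 0 = e 0)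
    (h : value q (tail 1 d) = value q (tail 1 e)) : value q d = value q e := by
  have h1 := mul_value hq d
  rw [h, h0, ← mul_value hq e] at h1
  exact mul_left_cancel₀ (by positivity) h1

theorem pow_mul_sub_value {q : ℝ} (hq : 1 < q) {d e : ℕ → Fin 3} {n : ℕ}
    (h : ∀ i < n, d i = e i) :
    q ^ n * (value q d - value q e) = value q (tail n d) - value q (tail n e) := by
  induction n with
  | zero => simp
  | succ n ih =>
    have h1 := ih fun i hi => h i (by omega)
    have h2 := mul_value hq (tail n d)
    have h3 := mul_value hq (tail n e)
    rw [tail_tail] at h2 h3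
    simp only [tail_apply, zero_add, h n (by omega)] at h2 h3
    rw [pow_succ', mul_assoc, h1]; linarith

theorem value_eq_iff_tail {q : ℝ} (hq : 1 < q) {d e : ℕ → Fin 3} {n : ℕ}
    (h : ∀ i < n, d i = e i) :
    value q d = value q e ↔ value q (tail n d) = value q (tail n e) := by
  rw [← sub_eq_zero, ← sub_eq_zero (a := value q (tail n d)), ← pow_mul_sub_value hq h]
  have : q ^ n ≠ 0 := by positivity
  simp [this]

theorem value_splice {q : ℝ} (hq : 1 < q) {d e : ℕ → Fin 3} {n : ℕ}
    (h : value q (tail n d) = value q e) : value q (splice n d e) = value q d := by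
  rw [value_eq_iff_tail hq fun i hi => splice_of_lt hi d e, tail_splice, h]

theorem continuous_value {q : ℝ} (hq : 1 < q) : Continuous (value q) := by
  refine continuous_tsum (u := fun i : ℕ => q / q ^ (i + 1)) (fun i => ?_)
    (summable_bound hq).summable fun i d => ?_
  · exact ((continuous_of_discreteTopology (f := digit q)).comp (continuous_apply i)).div_const _
  · rw [Real.norm_of_nonneg (term_nonneg hq d i)]
    exact term_le hq d i

theorem continuous_tail (n : ℕ) : Continuous (tail n) :=
  continuous_pi fun i => continuous_apply (i + n)

theorem value_const_zero {q : ℝ} : value q (fun _ => 0) = 0 := by simp [value]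

theorem value_const_two {q : ℝ} (hq : 1 < q) : value q (fun _ => 2) = top q :=
  (summable_bound hq).tsum_eq

theorem value_eq_zero_iff {q : ℝ} (hq : 1 < q) {d : ℕ → Fin 3} :
    value q d = 0 ↔ d = fun _ => 0 := by
  refine ⟨fun h => ?_, fun h => h ▸ value_const_zero⟩
  have h1 := hasSum_value hq d
  rw [h, hasSum_zero_iff_of_nonneg (term_nonneg hq d)] at h1
  funext i
  have h2 := congrFun h1 i
  have h3 : q ^ (i + 1) ≠ 0 := by positivity
  simp only [Pi.zero_apply, div_eq_zero_iff, h3, or_false] at h2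
  exact digit_injective hq h2

theorem value_eq_top_iff {q : ℝ} (hq : 1 < q) {d : ℕ → Fin 3} :
    value q d = top q ↔ d = fun _ => 2 := by
  refine ⟨fun h => ?_, fun h => h ▸ value_const_two hq⟩
  have h1 := (summable_bound hq).sub (hasSum_value hq d)
  rw [h, sub_self, hasSum_zero_iff_of_nonneg fun i => sub_nonneg.2 (term_le hq d i)] at h1
  funext i
  have h2 := congrFun h1 i
  have h3 : q ^ (i + 1) ≠ 0 := by positivity
  simp only [Pi.zero_apply, ← sub_div, div_eq_zero_iff, h3, or_false] at h2
  exact digit_injective hq (by simp; linarith)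

/-! ### Expansions as letter sequences -/

/-- The letter sequences of value `x`. -/
def codes (q x : ℝ) : Set (ℕ → Fin 3) := {d | value q d = x}

theorem isClosed_codes {q : ℝ} (hq : 1 < q) (x : ℝ) : IsClosed (codes q x) :=
  isClosed_singleton.preimage (continuous_value hq)

theorem image_codes {q : ℝ} (hq : 1 < q) (x : ℝ) :
    (fun d i => digit q (d i)) '' codes q x = expansions q x := by
  ext f
  constructor
  · rintro ⟨d, hd, rfl⟩
    refine ⟨fun i => ?_, hd ▸ hasSum_value hq d⟩
    rcases fin_three_cases (d i) with h | h | h <;> simp [h]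
  · rintro ⟨h1, h2⟩
    have : ∀ i, ∃ a, digit q a = f i := fun i => by
      rcases h1 i with h | h | h
      exacts [⟨0, by simp [h]⟩, ⟨1, by simp [h]⟩, ⟨2, by simp_all⟩]
    choose d hd using this
    refine ⟨d, ?_, funext hd⟩
    simp_rw [← hd] at h2
    exact (hasSum_value hq d).unique h2

theorem mk_expansions {q : ℝ} (hq : 1 < q) (x : ℝ) : #(expansions q x) = #(codes q x) := by
  rw [← image_codes hq]
  exact Cardinal.mk_image_eq fun d e h => funext fun i => digit_injective hq (congrFun h i)

theorem mem_E_iff {q : ℝ} (hq : 1 < q) {x : ℝ} : x ∈ E q ↔ ∃ d, value q d = x := by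
  rw [E, mem_ofPred_eq, ← image_codes hq, image_nonempty]; rfl

theorem mk_eq_aleph0_iff {α : Type} {s : Set α} : #s = ℵ₀ ↔ s.Countable ∧ s.Infinite := by
  rw [le_antisymm_iff, Cardinal.le_aleph0_iff_set_countable, ← Cardinal.infinite_iff,
    Set.infinite_coe_iff]

theorem mem_U_aleph0_iff {q : ℝ} (hq : 1 < q) {x : ℝ} :
    x ∈ U q ℵ₀ ↔ (codes q x).Countable ∧ (codes q x).Infinite := by
  rw [U, mem_ofPred_eq, mk_expansions hq, mk_eq_aleph0_iff, mem_E_iff hq]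
  exact ⟨fun h => h.2, fun h => ⟨h.2.nonempty, h⟩⟩

instance : PolishSpace (ℕ → Fin 3) where

theorem mem_U_continuum {q : ℝ} (hq : 1 < q) {x : ℝ} (h : ¬ (codes q x).Countable) :
    x ∈ U q (2 ^ ℵ₀) := by
  refine ⟨(mem_E_iff hq).2 ?_, ?_⟩
  · by_contra h'
    exact h (Set.Subsingleton.countable fun d hd => (h' ⟨d, hd⟩).elim)
  · rw [mk_expansions hq]
    apply le_antisymm
    · refine (Cardinal.mk_set_le _).trans ?_
      simpa using (Cardinal.nat_power_aleph0 (n := 3) (by norm_num)).le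
    · obtain ⟨f, hf, -, hinj⟩ :=
        (isClosed_codes hq x).exists_nat_bool_injection_of_not_countable h
      have := Cardinal.mk_le_of_injective (f := fun b => (⟨f b, hf ⟨b, rfl⟩⟩ : codes q x))
        fun a b hab => hinj (by simpa using hab)
      simpa using this

/-! ### Isolated sequences -/

theorem exists_cylinder_subset {d : ℕ → Fin 3} {s : Set (ℕ → Fin 3)} (hs : s ∈ 𝓝 d) :
    ∃ n, ∀ e : ℕ → Fin 3, (∀ i < n, e i = d i) → e ∈ s := by
  obtain ⟨_, ⟨x, n, rfl⟩, hd, hsub⟩ :=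
    (PiNat.isTopologicalBasis_cylinders fun _ : ℕ => Fin 3).mem_nhds_iff.1 hs
  refine ⟨n, fun e he => hsub ?_⟩
  rw [PiNat.mem_cylinder_iff] at hd ⊢
  exact fun i hi => (he i hi).trans (hd i hi)

/-- Otherwise the closed set is perfect and contains an injective image of Cantor space. -/
theorem exists_isolated {K : Set (ℕ → Fin 3)} (hK : IsClosed K) (hne : K.Nonempty)
    (hc : K.Countable) : ∃ d ∈ K, ∃ n, ∀ e ∈ K, (∀ i < n, e i = d i) → e = d := by
  by_contra! h
  let := TopologicalSpace.upgradeIsCompletelyMetrizable (ℕ → Fin 3)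
  have hp : Perfect K := by
    refine ⟨hK, preperfect_iff_nhds.2 fun d hd s hs => ?_⟩
    obtain ⟨n, hn⟩ := exists_cylinder_subset hs
    obtain ⟨e, he, h1, h2⟩ := h d hd n
    exact ⟨e, ⟨hn e h1, he⟩, h2⟩
  obtain ⟨f, hf, -, hinj⟩ := hp.exists_nat_bool_injection hne
  have h1 : (range f).Countable := hc.mono hf
  rw [← Cardinal.le_aleph0_iff_set_countable, Cardinal.mk_range_eq f hinj] at h1
  have h3 : #(ℕ → Bool) = 2 ^ ℵ₀ := by simp
  exact absurd h1 (not_le.2 (h3 ▸ Cardinal.cantor ℵ₀))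

/-- Exchanging the tail beyond the isolating prefix for one of equal value stays in the same
cylinder and in `codes q x`. The closed set `K` is `univ` in general, and a set of orbits kept off
the endpoints when `q < 2`. -/
theorem exists_isolated_tail {q : ℝ} (hq : 1 < q) {x : ℝ} {K : Set (ℕ → Fin 3)} (hK : IsClosed K)
    (hne : (codes q x ∩ K).Nonempty) (hc : (codes q x).Countable) :
    ∃ d ∈ codes q x ∩ K, ∃ n, ∀ e, value q e = value q (tail n d) →
      splice n d e ∈ K → e = tail n d := by
  obtain ⟨d, hd, n, hn⟩ := exists_isolated ((isClosed_codes hq x).inter hK) hne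
    (hc.mono inter_subset_left)
  refine ⟨d, hd, n, fun e he heK => ?_⟩
  rw [← hn (splice n d e) ⟨(value_splice hq he.symm).trans hd.1, heK⟩
    fun i hi => splice_of_lt hi d e, tail_splice]

/-- The sequence `d` is the only one of its value. -/
def IsUnivoque (q : ℝ) (d : ℕ → Fin 3) : Prop := ∀ e, value q e = value q d → e = d

theorem IsUnivoque.tail_one {q : ℝ} (hq : 1 < q) {d : ℕ → Fin 3} (hd : IsUnivoque q d) :
    IsUnivoque q (tail 1 d) := by
  intro e he
  have := hd (prepend (d 0) e) (value_eq_of_tail hq rfl he)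
  rw [← this, tail_one_prepend]

/-- The map that puts the finite word `l` in front of a point. -/
noncomputable def wordMap (q : ℝ) : List (Fin 3) → ℝ → ℝ
  | [], y => y
  | a :: l, y => (digit q a + wordMap q l y) / q

theorem exists_wordMap {q : ℝ} (hq : 1 < q) (n : ℕ) (d : ℕ → Fin 3) :
    ∃ l, wordMap q l (value q (tail n d)) = value q d := by
  induction n generalizing d with
  | zero => exact ⟨[], rfl⟩
  | succ n ih =>
    obtain ⟨l, hl⟩ := ih (tail 1 d)
    refine ⟨d 0 :: l, ?_⟩
    rw [tail_tail, add_comm] at hl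
    rw [wordMap, hl, ← mul_value hq, mul_div_cancel_left₀ _ (by positivity)]

theorem lipschitz_wordMap {q : ℝ} (hq : 1 < q) (l : List (Fin 3)) :
    LipschitzWith 1 (wordMap q l) := by
  induction l with
  | nil => exact LipschitzWith.id
  | cons a l ih =>
    refine LipschitzWith.of_dist_le_mul fun x y => ?_
    have h := ih.dist_le_mul x y
    rw [NNReal.coe_one, one_mul, Real.dist_eq] at h ⊢
    rw [wordMap, wordMap, ← sub_div, add_sub_add_left_eq_sub, abs_div, abs_of_pos (by linarith : 0 < q)]
    exact (div_le_self (abs_nonneg _) hq.le).trans h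

theorem exists_wordMap_univoque {q : ℝ} (hq : 1 < q) {x : ℝ} (hne : (codes q x).Nonempty)
    (hc : (codes q x).Countable) : ∃ l d, IsUnivoque q d ∧ wordMap q l (value q d) = x := by
  obtain ⟨d, ⟨hd, -⟩, n, hn⟩ := exists_isolated_tail hq isClosed_univ (by simpa using hne) hc
  obtain ⟨l, hl⟩ := exists_wordMap hq n d
  exact ⟨l, tail n d, fun e he => hn e he trivial, hl.trans hd⟩

/-! ### Existence of expansions -/

/-- Following the admissible digits, the error between a point and the value of its sequence grows
by the factor `q` at each step, yet stays bounded; so it vanishes. -/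
theorem exists_value_eq {q : ℝ} (hq : 1 < q) {I : Set ℝ} {C : ℝ} (hI : I ⊆ Icc 0 C)
    (h : ∀ y ∈ I, ∃ a, q * y - digit q a ∈ I) {y : ℝ} (hy : y ∈ I) :
    ∃ d, value q d = y ∧ ∀ n, value q (tail n d) ∈ I := by
  choose! f hf using h
  set g : ℝ → ℝ := fun z => q * z - digit q (f z) with hg
  set c : ℝ → ℕ → Fin 3 := fun z n => f (g^[n] z) with hcdef
  have hc : ∀ z, tail 1 (c z) = c (g z) := fun z => rfl
  have hb : ∀ n : ℕ, ∀ z ∈ I, |z - value q (c z)| * q ^ n ≤ C + top q := by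
    intro n
    induction n with
    | zero =>
      intro z hz
      have h1 := hI hz
      have h2 := value_nonneg hq (c z)
      have h3 := value_le_top hq (c z)
      have h4 := top_pos hq
      rw [pow_zero, mul_one, abs_le]
      constructor <;> linarith [h1.1, h1.2]
    | succ n ih =>
      intro z hz
      have h1 := ih (g z) (hf z hz)
      have h2 := mul_value hq (c z)
      rw [hc] at h2
      have h3 : g z - value q (c (g z)) = q * (z - value q (c z)) := by
        rw [mul_sub, h2]; simp only [hg, hcdef, Function.iterate_zero, id]; ring
      rw [h3, abs_mul, abs_of_pos (by linarith : 0 < q)] at h1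
      rw [pow_succ]; linarith
  have hval : ∀ z ∈ I, value q (c z) = z := by
    intro z hz
    by_contra hne
    have hpos : 0 < |z - value q (c z)| := abs_pos.2 (sub_ne_zero.2 (Ne.symm hne))
    obtain ⟨n, hn⟩ := pow_unbounded_of_one_lt ((C + top q) / |z - value q (c z)|) hq
    rw [div_lt_iff₀ hpos] at hn
    linarith [hb n z hz]
  have horb : ∀ n : ℕ, g^[n] y ∈ I := by
    intro n
    induction n with
    | zero => exact hy
    | succ n ih => rw [Function.iterate_succ_apply']; exact hf _ ih
  refine ⟨c y, hval y hy, fun n => ?_⟩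
  have : tail n (c y) = c (g^[n] y) := by
    funext i
    simp [hcdef, Function.iterate_add_apply]
  rw [this, hval _ (horb n)]; exact horb n

/-- The condition on `q` says `q - 1 ≤ top q`: the intervals of length `top q` starting at 0, 1 and
`q` then cover `[0, q * top q]`. -/
theorem exists_value_eq_of_mem_Icc {q : ℝ} (hq : 1 < q) (hq' : q ^ 2 ≤ 3 * q - 1) {y : ℝ}
    (hy : y ∈ Icc 0 (top q)) : ∃ d, value q d = y := by
  have hM := mul_top hq
  have hM1 : q - 1 ≤ top q := by
    rw [top, le_div_iff₀ (by linarith)]; nlinarith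
  have hM2 : 1 ≤ top q := by
    rw [top, le_div_iff₀ (by linarith)]; linarith
  have hstep : ∀ z ∈ Icc 0 (top q), ∃ a, q * z - digit q a ∈ Icc 0 (top q) := fun z hz => by
    have h1 := mul_nonneg (by linarith : 0 ≤ q) hz.1
    have h2 := mul_le_mul_of_nonneg_left hz.2 (by linarith : 0 ≤ q)
    rcases le_total (q * z) (top q) with h | h
    · exact ⟨0, by simp; constructor <;> linarith⟩
    rcases le_total (q * z) (1 + top q) with h' | h'
    · exact ⟨1, by simp; constructor <;> linarith⟩
    · exact ⟨2, by simp only [digit_two]; constructor <;> linarith⟩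
  obtain ⟨d, hd, -⟩ := exists_value_eq hq subset_rfl hstep hy
  exact ⟨d, hd⟩

theorem E_eq_Icc {q : ℝ} (hq : 1 < q) (hq' : q ^ 2 ≤ 3 * q - 1) : E q = Icc 0 (top q) := by
  ext x
  rw [mem_E_iff hq]
  refine ⟨?_, exists_value_eq_of_mem_Icc hq hq'⟩
  rintro ⟨d, rfl⟩
  exact ⟨value_nonneg hq d, value_le_top hq d⟩

/-! ### Univoque sequences in small bases -/

theorem IsUnivoque.digit_eq {q : ℝ} (hq : 1 < q) (hq' : q ^ 2 ≤ 3 * q - 1) {d : ℕ → Fin 3}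
    (hd : IsUnivoque q d) {a : Fin 3} (h0 : digit q a ≤ q * value q d)
    (h1 : q * value q d ≤ digit q a + top q) : d 0 = a := by
  obtain ⟨e, he⟩ := exists_value_eq_of_mem_Icc hq hq'
    (y := q * value q d - digit q a) ⟨by linarith, by linarith⟩
  have := hd (prepend a e) (mul_left_cancel₀ (by positivity : q ≠ 0) (by
    rw [value_prepend hq, he]; ring))
  rw [← this]; rfl

theorem eq_const_of_forall_tail {d : ℕ → Fin 3} {a : Fin 3} {p : (ℕ → Fin 3) → Prop}
    (hp : ∀ e, p e → e 0 = a ∧ p (tail 1 e)) (hd : p d) : d = fun _ => a := by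
  have h : ∀ n, p (tail n d) := fun n => by
    induction n with
    | zero => exact hd
    | succ n ih => rw [← tail_tail]; exact (hp _ ih).2
  funext n
  simpa using (hp _ (h n)).1

theorem value_const_one {q : ℝ} (hq : 1 < q) : value q (fun _ => 1) = top q - 1 := by
  have h := mul_value hq (fun _ => 1)
  have h1 : tail 1 (fun _ : ℕ => (1 : Fin 3)) = fun _ => 1 := rfl
  rw [h1, digit_one] at h
  have h2 := mul_top hq
  have : (q - 1) * (value q (fun _ => 1) - (top q - 1)) = 0 := by linarith
  rcases mul_eq_zero.1 this with h | h <;> linarith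

/-- Each digit confines the value of the next tail, since no other digit may be admissible. These
bounds force 1 to be followed by 1 forever, which violates a strict bound; without the letter 1,
both 02 and 20 are excluded as well. -/
theorem IsUnivoque.eq_const {q : ℝ} (hq : 1 < q) (hP : q ^ 3 - 3 * q ^ 2 + 2 * q - 1 ≤ 0)
    {d : ℕ → Fin 3} (hd : IsUnivoque q d) : d = (fun _ => 0) ∨ d = fun _ => 2 := by
  have hq' : q ^ 2 ≤ 3 * q - 1 := by
    by_contra! h
    have : 2 < q := by nlinarith
    nlinarith
  have hM := mul_top hq
  -- Both this and `hM2` are `hP` in disguise: multiply by `q - 1` and use `(q - 1) * top q = q`.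
  have hM1 : 1 ≤ q * (1 + top q - q) := by
    have : q * (1 + top q - q) = 2 * q - q ^ 2 + top q := by linarith [mul_top hq]
    have h2 : (q - 1) * top q = q := by linarith
    have h3 : 0 ≤ (q - 1) * (2 * q - q ^ 2 + top q - 1) := by nlinarith
    have := nonneg_of_mul_nonneg_right h3 (by linarith)
    linarith
  have hM2 : q * (q - 2) ≤ top q - 1 := by
    have h2 : (q - 1) * top q = q := by linarith
    have h3 : 0 ≤ (q - 1) * (top q - 1 - q * (q - 2)) := by nlinarith
    have := nonneg_of_mul_nonneg_right h3 (by linarith)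
    linarith
  have hM3 : 1 < top q := by
    rw [top, lt_div_iff₀ (by linarith)]; linarith
  have r0 : ∀ e, IsUnivoque q e → e 0 = 0 → value q (tail 1 e) < 1 := fun e he h0 => by
    have h := mul_value hq e
    rw [h0, digit_zero] at h
    by_contra! hc
    have := he.digit_eq hq hq' (a := 1) (by simp; linarith)
      (by simp; linarith [value_le_top hq (tail 1 e)])
    simp [h0] at this
  have r1 : ∀ e, IsUnivoque q e → e 0 = 1 →
      top q - 1 < value q (tail 1 e) ∧ value q (tail 1 e) < q - 1 := fun e he h0 => by
    have h := mul_value hq e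
    rw [h0, digit_one] at h
    constructor
    · by_contra! hc
      have := he.digit_eq hq hq' (a := 0)
        (by simp only [digit_zero]; linarith [value_nonneg hq (tail 1 e)])
        (by simp only [digit_zero]; linarith)
      simp [h0] at this
    · by_contra! hc
      have := he.digit_eq hq hq' (a := 2) (by simp only [digit_two]; linarith)
        (by simp only [digit_two]; linarith [value_le_top hq (tail 1 e)])
      simp [h0] at this
  have r2 : ∀ e, IsUnivoque q e → e 0 = 2 → 1 + top q - q < value q (tail 1 e) :=
      fun e he h0 => by
    have h := mul_value hq e
    rw [h0, digit_two] at h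
    by_contra! hc
    have := he.digit_eq hq hq' (a := 1)
      (by simp only [digit_one]; linarith [value_nonneg hq (tail 1 e)])
      (by simp only [digit_one]; linarith)
    simp [h0] at this
  have one_one : ∀ e, IsUnivoque q e → e 0 = 1 → tail 1 e 0 = 1 := fun e he h0 => by
    obtain ⟨l1, u1⟩ := r1 e he h0
    have he1 := he.tail_one hq
    have h1 := mul_value hq (tail 1 e)
    have hl : top q < q * value q (tail 1 e) := by nlinarith
    rcases fin_three_cases (tail 1 e 0) with h | h | h
    · have := r0 _ he1 h
      rw [h, digit_zero] at h1; linarith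
    · exact h
    -- After the word 12 the remaining value `w` is below `top q - 1`, too small for a next letter 1
    -- or 2; the bound `r2` makes it too large for 0.
    · exfalso
      have h2 := r2 _ he1 h
      rw [h, digit_two] at h1
      have he2 := he1.tail_one hq
      have h3 := mul_value hq (tail 1 (tail 1 e))
      set w := value q (tail 1 (tail 1 e)) with hw
      have hw1 : w < top q - 1 := by nlinarith
      have hw2 : q * w < top q := by nlinarith
      rcases fin_three_cases (tail 1 (tail 1 e) 0) with h' | h' | h'
      · have := r0 _ he2 h'
        rw [h', digit_zero] at h3
        nlinarith
      · have := (r1 _ he2 h').1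
        rw [h', digit_one] at h3; linarith
      · have := r2 _ he2 h'
        rw [h', digit_two] at h3; linarith
  have ne_one : ∀ e, IsUnivoque q e → e 0 ≠ 1 := fun e he h0 => by
    have hc := eq_const_of_forall_tail (p := fun e => IsUnivoque q e ∧ e 0 = 1)
      (fun e he => ⟨he.2, he.1.tail_one hq, one_one e he.1 he.2⟩) ⟨he, h0⟩
    have := (r1 e he h0).1
    have h1 : tail 1 (fun _ : ℕ => (1 : Fin 3)) = fun _ => 1 := rfl
    rw [hc, h1, value_const_one hq] at this
    exact lt_irrefl _ this
  have zero_const : ∀ e, IsUnivoque q e → e 0 = 0 → e = fun _ => 0 := fun e he h0 => by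
    refine eq_const_of_forall_tail (p := fun e => IsUnivoque q e ∧ e 0 = 0)
      (fun e he => ⟨he.2, he.1.tail_one hq, ?_⟩) ⟨he, h0⟩
    have h1 := mul_value hq (tail 1 e)
    have h2 := r0 e he.1 he.2
    rcases fin_three_cases (tail 1 e 0) with h | h | h
    · exact h
    · exact absurd h (ne_one _ (he.1.tail_one hq))
    · rw [h, digit_two] at h1
      nlinarith [value_nonneg hq (tail 1 (tail 1 e))]
  rcases fin_three_cases (d 0) with h | h | h
  · exact Or.inl (zero_const d hd h)
  · exact absurd h (ne_one d hd)
  · refine Or.inr (eq_const_of_forall_tail (p := fun e => IsUnivoque q e ∧ e 0 = 2)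
      (fun e he => ⟨he.2, he.1.tail_one hq, ?_⟩) ⟨hd, h⟩)
    rcases fin_three_cases (tail 1 e 0) with h' | h' | h'
    · have h1 := r2 e he.1 he.2
      rw [zero_const _ (he.1.tail_one hq) h', value_const_zero] at h1
      nlinarith
    · exact absurd h' (ne_one _ (he.1.tail_one hq))
    · exact h'

/-! ### Bases less than two -/

/-- Digits 0 and 2 alone keep an orbit away from the endpoints. If there were only countably many
expansions, some orbit would never have a choice inside `I`; it would then repeat 0 or 2 forever and
be expelled from `I`. -/
theorem not_countable_codes_of_lt_two {q : ℝ} (hq : 1 < q) (hq2 : q < 2) {x : ℝ} (h0 : 0 < x)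
    (h1 : x < top q) : ¬ (codes q x).Countable := by
  intro hc
  have hM := mul_top hq
  have hMq : q < top q := by
    rw [top, lt_div_iff₀ (by linarith)]; nlinarith
  obtain ⟨ε, hε, hεx, hεM, hε4⟩ : ∃ ε > 0, ε ≤ x ∧ ε ≤ top q - x ∧ 4 * ε ≤ top q - q :=
    ⟨min (min x (top q - x)) ((top q - q) / 4),
      lt_min (lt_min h0 (by linarith)) (by linarith),
      (min_le_left _ _).trans (min_le_left _ _), (min_le_left _ _).trans (min_le_right _ _), by
        linarith [min_le_right (min x (top q - x)) ((top q - q) / 4)]⟩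
  set I : Set ℝ := Icc ε (top q - ε) with hI
  have hI0 : I ⊆ Icc 0 (top q) := Icc_subset_Icc hε.le (by linarith)
  have low : ∀ z ∈ I, q * z ≤ top q - ε → q * z - digit q 0 ∈ I := fun z hz h => by
    have := hz.1
    rw [digit_zero, sub_zero]
    exact ⟨by nlinarith, h⟩
  have high : ∀ z ∈ I, q + ε ≤ q * z → q * z - digit q 2 ∈ I := fun z hz h => by
    have := hz.2
    rw [digit_two]
    exact ⟨by linarith, by nlinarith⟩
  have hstep : ∀ z ∈ I, ∃ a, q * z - digit q a ∈ I := fun z hz => by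
    rcases le_total (q * z) (top q - ε) with h | h
    · exact ⟨0, low z hz h⟩
    · exact ⟨2, high z hz (by linarith)⟩
  -- Restricting to `K` rules out the constant sequences 0 and 2, which are univoque in every base.
  set K : Set (ℕ → Fin 3) := {d | ∀ n, value q (tail n d) ∈ I} with hK
  have hKc : IsClosed K := by
    rw [hK, ofPred_forall]
    exact isClosed_iInter fun n =>
      isClosed_Icc.preimage ((continuous_value hq).comp (continuous_tail n))
  have hKt : ∀ n, ∀ d ∈ K, tail n d ∈ K := fun n d hd m => by
    rw [tail_tail]; exact hd _
  have hKp : ∀ a, ∀ d ∈ K, value q (prepend a d) ∈ I → prepend a d ∈ K := by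
    intro a d hd h n
    cases n with
    | zero => exact h
    | succ n => rw [add_comm, ← tail_tail, tail_one_prepend]; exact hd n
  obtain ⟨c, hcx, hcK⟩ := exists_value_eq hq hI0 hstep (y := x) ⟨hεx, by linarith⟩
  obtain ⟨d, hd, n, hn⟩ := exists_isolated_tail hq hKc ⟨c, hcx, hcK⟩ hc
  -- `T` holds for the sequences that are alone in `K` with their value
  set T : (ℕ → Fin 3) → Prop := fun d => d ∈ K ∧ ∀ e ∈ K, value q e = value q d → e = d with hT
  have hTn : T (tail n d) := by
    refine ⟨hKt n d hd.2, fun e he hv => hn e hv fun m => ?_⟩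
    rcases le_or_gt n m with h | h
    · obtain ⟨k, rfl⟩ := Nat.exists_eq_add_of_le h
      rw [← tail_tail, tail_splice]; exact he k
    · have : value q (tail m (splice n d e)) = value q (tail m d) := by
        rw [← value_eq_iff_tail hq fun i hi => splice_of_lt (hi.trans h) d e,
          value_splice hq hv.symm]
      rw [this]; exact hd.2 m
  have hTt : ∀ e, T e → T (tail 1 e) := by
    refine fun e he => ⟨hKt 1 e he.1, fun f hf hv => ?_⟩
    have h2 : value q (prepend (e 0) f) = value q e := value_eq_of_tail hq rfl hv
    rw [← he.2 _ (hKp _ f hf (h2 ▸ he.1 0)) h2, tail_one_prepend]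
  have hdig : ∀ e, T e → ∀ a, q * value q e - digit q a ∈ I → e 0 = a := by
    intro e he a ha
    obtain ⟨f, hf, hfK⟩ := exists_value_eq hq hI0 hstep ha
    have h2 : value q (prepend a f) = value q e := mul_left_cancel₀ (by positivity : q ≠ 0) (by
      rw [value_prepend hq, hf]; ring)
    rw [← he.2 _ (hKp a f hfK (h2 ▸ he.1 0)) h2, prepend_zero]
  -- In the middle range digit 1 is admissible within `I`, and so is 0 or 2, contradicting
  -- uniqueness in `K`.
  have hdich : ∀ e, T e → q * value q e < 1 + ε ∨ 1 + top q - ε < q * value q e := by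
    intro e he
    by_contra! h
    have ha := hdig e he 1 (by rw [digit_one]; constructor <;> linarith)
    rcases le_total (q * value q e) (top q - ε) with h' | h'
    · simp [hdig e he 0 (low _ (he.1 0) h')] at ha
    · simp [hdig e he 2 (high _ (he.1 0) (by linarith))] at ha
  -- A low point must take digit 0. Its image is multiplied by `q < 2`, too little to jump over the
  -- middle range, so it is low again.
  have hlow : ∀ e, T e → q * value q e < 1 + ε →
      value q (tail 1 e) = q * value q e ∧ q * value q (tail 1 e) < 1 + ε := by
    intro e he h
    have h1 := mul_value hq e
    rw [hdig e he 0 (low _ (he.1 0) (by linarith)), digit_zero] at h1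
    refine ⟨by linarith, (hdich _ (hTt e he)).resolve_right ?_⟩
    rw [← zero_add (value q (tail 1 e)), ← h1]
    nlinarith
  have hhigh : ∀ e, T e → 1 + top q - ε < q * value q e →
      top q - value q (tail 1 e) = q * (top q - value q e) ∧
        1 + top q - ε < q * value q (tail 1 e) := by
    intro e he h
    have h1 := mul_value hq e
    rw [hdig e he 2 (high _ (he.1 0) (by linarith)), digit_two] at h1
    refine ⟨by linarith, (hdich _ (hTt e he)).resolve_left ?_⟩
    have : 1 + ε < value q (tail 1 e) := by linarith
    nlinarith
  rcases hdich _ hTn with h | h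
  · have hiter : ∀ m, ∀ e, T e → q * value q e < 1 + ε → q ^ (m + 1) * value q e < 1 + ε := by
      intro m
      induction m with
      | zero => intro e _ h; simpa using h
      | succ m ih =>
        intro e he h
        obtain ⟨h2, h3⟩ := hlow e he h
        have := ih _ (hTt e he) h3
        rw [h2] at this
        rw [pow_succ]; linarith
    obtain ⟨m, hm⟩ := pow_unbounded_of_one_lt ((1 + ε) / ε) hq
    rw [div_lt_iff₀ hε] at hm
    have h2 := hiter m _ hTn h
    have h3 := (hTn.1 0).1
    rw [tail_zero] at h3
    have h4 : q ^ m ≤ q ^ (m + 1) := pow_le_pow_right₀ hq.le (by omega)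
    have h5 := mul_le_mul h4 h3 hε.le (by positivity)
    linarith
  · have hiter : ∀ m, ∀ e, T e → 1 + top q - ε < q * value q e →
        q ^ m * (top q - value q e) ≤ top q := by
      intro m
      induction m with
      | zero => intro e _ _; linarith [value_nonneg hq e]
      | succ m ih =>
        intro e he h
        obtain ⟨h2, h3⟩ := hhigh e he h
        have := ih _ (hTt e he) h3
        rw [h2] at this
        rw [pow_succ]; linarith
    obtain ⟨m, hm⟩ := pow_unbounded_of_one_lt (top q / ε) hq
    rw [div_lt_iff₀ hε] at hm
    have h2 := hiter m _ hTn h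
    have h3 := (hTn.1 0).2
    rw [tail_zero] at h3
    have h5 := mul_le_mul_of_nonneg_left (by linarith : ε ≤ top q - value q (tail n d))
      (by positivity : 0 ≤ q ^ m)
    linarith

/-! ### Infinitely many points with countably many expansions -/

theorem codes_zero {q : ℝ} (hq : 1 < q) : codes q 0 = {fun _ => 0} :=
  ext fun _ => value_eq_zero_iff hq

theorem codes_top {q : ℝ} (hq : 1 < q) : codes q (top q) = {fun _ => 2} :=
  ext fun _ => value_eq_top_iff hq

theorem mem_Ioo_of_mem_U {q : ℝ} (hq : 1 < q) {x : ℝ} (hx : x ∈ U q ℵ₀) : x ∈ Ioo 0 (top q) := by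
  have hx' := ((mem_U_aleph0_iff hq).1 hx).2
  obtain ⟨d, hd⟩ := hx'.nonempty
  have hd : value q d = x := hd
  refine ⟨(hd ▸ value_nonneg hq d).lt_of_ne ?_, (hd ▸ value_le_top hq d).lt_of_ne ?_⟩
  · rintro rfl
    rw [codes_zero hq] at hx'
    exact hx' (finite_singleton _)
  · rintro rfl
    rw [codes_top hq] at hx'
    exact hx' (finite_singleton _)

theorem prepend_image_subset_codes {q : ℝ} (hq : 1 < q) (a : Fin 3) (x : ℝ) :
    prepend a '' codes q x ⊆ codes q ((digit q a + x) / q) := by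
  rintro _ ⟨d, hd, rfl⟩
  have h := value_prepend hq a d
  rw [show value q d = x from hd] at h
  exact (eq_div_iff (by positivity)).2 (by linarith)

/-- Split the expansions by first digit: digit `a` contributes the infinitely many expansions of
`x`, every other digit countably many. -/
theorem mem_U_div {q : ℝ} (hq : 1 < q) (a : Fin 3) {x : ℝ} (hx : x ∈ U q ℵ₀)
    (h : ∀ b, b ≠ a → (codes q (digit q a + x - digit q b)).Countable) :
    (digit q a + x) / q ∈ U q ℵ₀ := by
  obtain ⟨hc, hi⟩ := (mem_U_aleph0_iff hq).1 hx
  refine (mem_U_aleph0_iff hq).2 ⟨?_, (hi.image (prepend_injective a).injOn).mono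
    (prepend_image_subset_codes hq a x)⟩
  have hsub : codes q ((digit q a + x) / q) ⊆
      ⋃ b, prepend b '' codes q (digit q a + x - digit q b) := by
    intro d hd
    refine mem_iUnion.2 ⟨d 0, tail 1 d, ?_, prepend_tail d⟩
    have h1 := mul_value hq d
    rw [show value q d = _ from hd, mul_div_cancel₀ _ (by positivity : q ≠ 0)] at h1
    simp only [codes, mem_ofPred_eq]; linarith
  refine (countable_iUnion fun b => Countable.image ?_ _).mono hsub
  by_cases hb : b = a
  · subst hb; simpa using hc
  · exact h b hb

theorem codes_eq_empty_of_neg {q : ℝ} (hq : 1 < q) {x : ℝ} (hx : x < 0) : codes q x = ∅ := by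
  refine eq_empty_iff_forall_notMem.2 fun d hd => ?_
  linarith [value_nonneg hq d, show value q d = x from hd]

theorem codes_eq_empty_of_top_lt {q : ℝ} (hq : 1 < q) {x : ℝ} (hx : top q < x) :
    codes q x = ∅ := by
  refine eq_empty_iff_forall_notMem.2 fun d hd => ?_
  linarith [value_le_top hq d, show value q d = x from hd]

theorem infinite_U_of_lt_one {q : ℝ} (hq : 1 < q) {x : ℝ} (hx : x ∈ U q ℵ₀) (h1 : x < 1) :
    (U q ℵ₀).Infinite := by
  have h0 := (mem_Ioo_of_mem_U hq hx).1
  have hmem : ∀ n : ℕ, x / q ^ n ∈ U q ℵ₀ := fun n => by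
    induction n with
    | zero => simpa using hx
    | succ n ih =>
      have h2 : x / q ^ n < 1 := (div_le_self h0.le (one_le_pow₀ hq.le)).trans_lt h1
      have := mem_U_div hq 0 ih fun b hb => by
        rw [codes_eq_empty_of_neg hq]
        · exact countable_empty
        · rcases fin_three_cases b with rfl | rfl | rfl
          · exact absurd rfl hb
          · simpa using h2
          · simp; linarith
      rwa [digit_zero, zero_add, div_div, ← pow_succ] at this
  refine infinite_of_injective_forall_mem (f := fun n : ℕ => x / q ^ n) (fun m n h => ?_) hmem
  have h3 : q ^ m = q ^ n := by
    simp only at h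
    rw [div_eq_div_iff (by positivity) (by positivity)] at h
    exact (mul_left_cancel₀ h0.ne' h).symm
  exact pow_right_injective₀ (by linarith) hq.ne' h3

theorem infinite_U_of_gt {q : ℝ} (hq : 1 < q) {x : ℝ} (hx : x ∈ U q ℵ₀)
    (h1 : top q - (q - 1) < x) : (U q ℵ₀).Infinite := by
  have h0 := (mem_Ioo_of_mem_U hq hx).2
  have hM := mul_top hq
  have hmem : ∀ n : ℕ, top q - (top q - x) / q ^ n ∈ U q ℵ₀ := fun n => by
    induction n with
    | zero => simpa using hx
    | succ n ih =>
      have h2 : (top q - x) / q ^ n < q - 1 :=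
        (div_le_self (by linarith) (one_le_pow₀ hq.le)).trans_lt (by linarith)
      have := mem_U_div hq 2 ih fun b hb => by
        rw [codes_eq_empty_of_top_lt hq]
        · exact countable_empty
        · rcases fin_three_cases b with rfl | rfl | rfl
          · simp; linarith
          · simp; linarith
          · exact absurd rfl hb
      convert this using 1
      rw [digit_two, pow_succ]; field_simp; linear_combination q ^ n * hM
  refine infinite_of_injective_forall_mem (f := fun n : ℕ => top q - (top q - x) / q ^ n)
    (fun m n h => ?_) hmem
  have h3 : q ^ m = q ^ n := by
    simp only [sub_right_inj] at h
    rw [div_eq_div_iff (by positivity) (by positivity)] at h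
    exact (mul_left_cancel₀ (by linarith) h).symm
  exact pow_right_injective₀ (by linarith) hq.ne' h3

theorem infinite_U {q : ℝ} (hq : 1 < q) {x : ℝ} (hx : x ∈ U q ℵ₀) : (U q ℵ₀).Infinite := by
  have hM := mul_top hq
  rcases lt_or_ge q 2 with hq2 | hq2
  · have := mem_Ioo_of_mem_U hq hx
    exact absurd ((mem_U_aleph0_iff hq).1 hx).1
      (not_countable_codes_of_lt_two hq hq2 this.1 this.2)
  by_cases h1 : x < 1
  · exact infinite_U_of_lt_one hq hx h1
  by_cases h2 : top q - (q - 1) < x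
  · exact infinite_U_of_gt hq hx h2
  -- The two ranges cover everything for `q > 2`; at `q = 2` they miss only the point 1, whose half
  -- lies in the first range.
  obtain rfl : q = 2 := by nlinarith
  obtain rfl : x = 1 := by linarith
  refine infinite_U_of_lt_one hq (x := (digit 2 0 + 1) / 2) (mem_U_div hq 0 hx fun b hb => ?_)
    (by norm_num)
  rcases fin_three_cases b with rfl | rfl | rfl
  · exact absurd rfl hb
  · simp [codes_zero hq]
  · rw [codes_eq_empty_of_neg hq (by simp)]
    exact countable_empty

/-! ### Small bases -/

theorem countable_U_of_small {q : ℝ} (hq : 1 < q) (hP : q ^ 3 - 3 * q ^ 2 + 2 * q - 1 ≤ 0) :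
    (U q ℵ₀).Countable := by
  have hsub : U q ℵ₀ ⊆ ⋃ l, wordMap q l '' {0, top q} := by
    intro x hx
    obtain ⟨hc, hi⟩ := (mem_U_aleph0_iff hq).1 hx
    obtain ⟨l, d, hd, hl⟩ := exists_wordMap_univoque hq hi.nonempty hc
    refine mem_iUnion.2 ⟨l, _, ?_, hl⟩
    rcases hd.eq_const hq hP with rfl | rfl
    · exact Or.inl value_const_zero
    · exact Or.inr (value_const_two hq)
  exact (countable_iUnion fun l => ((toFinite _).countable.image _)).mono hsub

/-! ### Large bases -/

theorem top_le {q : ℝ} (hq : 1 < q) (hq' : 3 * q - 1 ≤ q ^ 2) : top q ≤ q - 1 := by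
  rw [top, div_le_iff₀ (by linarith)]; nlinarith

/-- Since `top q ≤ q - 1`, the cylinders of the words 00 and 01 can meet that of 1 at most in the
point 1/q, the value of 1 followed by zeros. -/
theorem eq_of_value_eq_zero_left {q : ℝ} (hq : 1 < q) (hq' : 3 * q - 1 ≤ q ^ 2) {d e : ℕ → Fin 3}
    (h : value q d = value q e) (hd : d 0 = 0) (he : e 0 ≠ 0) :
    tail 1 e = (fun _ => 0) ∨ d 1 = 2 ∧ e 0 = 1 := by
  have hM := top_le hq hq'
  have h1 := mul_value hq d
  have h2 := mul_value hq e
  have h3 := mul_value hq (tail 1 d)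
  rw [hd, digit_zero, zero_add, h] at h1
  rw [← value_eq_zero_iff hq]
  have h4 := value_nonneg hq (tail 1 e)
  have h5 := value_le_top hq (tail 1 d)
  have h6 := value_le_top hq (tail 1 (tail 1 d))
  rcases fin_three_cases (e 0) with h' | h' | h'
  · exact absurd h' he
  · rw [h', digit_one] at h2
    rcases fin_three_cases (d 1) with h7 | h7 | h7
    · rw [tail_apply, zero_add, h7, digit_zero] at h3
      left; nlinarith
    · rw [tail_apply, zero_add, h7, digit_one] at h3
      left; nlinarith
    · exact Or.inr ⟨h7, h'⟩
  · rw [h', digit_two] at h2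
    linarith

theorem first_digits_of_value_eq {q : ℝ} (hq : 1 < q) (hq' : 3 * q - 1 ≤ q ^ 2)
    {d e : ℕ → Fin 3} (h : value q d = value q e) (hne : d 0 ≠ e 0) :
    (tail 1 d = fun _ => 0) ∨ (tail 1 e = fun _ => 0) ∨ (d 0 = 0 ∧ d 1 = 2 ∧ e 0 = 1) ∨
      (e 0 = 0 ∧ e 1 = 2 ∧ d 0 = 1) := by
  by_cases hd : d 0 = 0
  · have := eq_of_value_eq_zero_left hq hq' h hd fun h0 => hne (hd.trans h0.symm)
    tauto
  by_cases he : e 0 = 0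
  · have := eq_of_value_eq_zero_left hq hq' h.symm he hd
    tauto
  have hM := top_le hq hq'
  have h1 := mul_value hq d
  have h2 := mul_value hq e
  rw [← value_eq_zero_iff hq, ← value_eq_zero_iff hq]
  have h3 := value_nonneg hq (tail 1 d)
  have h4 := value_nonneg hq (tail 1 e)
  have h5 := value_le_top hq (tail 1 d)
  have h6 := value_le_top hq (tail 1 e)
  rcases fin_three_cases (d 0) with hd' | hd' | hd' <;>
    rcases fin_three_cases (e 0) with he' | he' | he'
  · exact absurd hd' hd
  · exact absurd hd' hd
  · exact absurd hd' hd
  · exact absurd he' he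
  · exact absurd (hd'.trans he'.symm) hne
  · rw [hd', digit_one, h] at h1
    rw [he', digit_two] at h2
    right; left; linarith
  · exact absurd he' he
  · rw [hd', digit_two, h] at h1
    rw [he', digit_one] at h2
    left; linarith
  · exact absurd (hd'.trans he'.symm) hne

/-- No expansion of `x` ends in a constant sequence. -/
def NoConstTail (q x : ℝ) : Prop := ∀ e, value q e = x → ∀ n a, tail n e ≠ fun _ => a

theorem NoConstTail.tail {q : ℝ} (hq : 1 < q) {d : ℕ → Fin 3} (h : NoConstTail q (value q d))
    (n : ℕ) : NoConstTail q (value q (tail n d)) := by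
  intro e he k a hk
  refine h (splice n d e) (value_splice hq he.symm) (n + k) a ?_
  rw [← tail_tail, tail_splice, hk]

/-- Rewrite the initial 02 of `e` as 10 and cancel the common 1. If `d` has no word 10, its next
letter is nonzero, and `first_digits_of_value_eq` recreates the same situation one place later; so
`d` would be constantly 1. -/
theorem exists_one_zero {q : ℝ} (hq : 1 < q) (hq' : 3 * q - 1 ≤ q ^ 2) {d e : ℕ → Fin 3}
    (hnc : NoConstTail q (value q d)) (h : value q e = value q d) (he0 : e 0 = 0) (he1 : e 1 = 2)
    (hd0 : d 0 = 1) : ∃ k, d k = 1 ∧ d (k + 1) = 0 := by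
  by_contra! hk
  refine hnc d rfl 0 1 (eq_const_of_forall_tail (p := fun d => NoConstTail q (value q d) ∧
    (∀ k, d k = 1 → d (k + 1) ≠ 0) ∧ d 0 = 1 ∧ ∃ e, value q e = value q d ∧ e 0 = 0 ∧ e 1 = 2)
    ?_ ⟨hnc, hk, hd0, e, h, he0, he1⟩)
  rintro d ⟨hnc, hk, hd0, e, h, he0, he1⟩
  have h1 := mul_value hq d
  have h2 := mul_value hq e
  have h3 := mul_value hq (QExpansion.tail 1 e)
  have h4 := value_prepend hq 0 (QExpansion.tail 1 (QExpansion.tail 1 e))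
  rw [hd0, digit_one] at h1
  rw [he0, digit_zero, h, h1] at h2
  rw [tail_apply, zero_add, he1, digit_two] at h3
  rw [digit_zero] at h4
  have h5 : value q (prepend 0 (QExpansion.tail 1 (QExpansion.tail 1 e))) =
      value q (QExpansion.tail 1 d) :=
    mul_left_cancel₀ (by positivity : q ≠ 0) (by nlinarith)
  have hnc1 := hnc.tail hq 1
  have hd1 : QExpansion.tail 1 d 0 ≠ 0 := hk 0 hd0
  have h6 : QExpansion.tail 1 d 0 = 1 ∧
      (prepend 0 (QExpansion.tail 1 (QExpansion.tail 1 e))) 1 = 2 := by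
    rcases first_digits_of_value_eq hq hq' h5 (by simpa using hd1.symm) with h | h | h | h
    · exact absurd h (hnc1 _ h5 1 0)
    · exact absurd h (hnc1 _ rfl 1 0)
    · exact ⟨h.2.2, h.2.1⟩
    · exact absurd h.1 hd1
  exact ⟨hd0, hnc1, fun k => hk (k + 1), h6.1, _, h5, rfl, h6.2⟩

/-- The sequence `d` with letters `a`, `b` written at the positions `i`, `i + 1` for `i ∈ A`. -/
noncomputable def swap (a b : Fin 3) (A : Set ℕ) (d : ℕ → Fin 3) : ℕ → Fin 3 := fun i =>
  open Classical in if i ∈ A then a else if ∃ j ∈ A, j + 1 = i then b else d i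

/-- The changes at `i` and `i + 1` cancel: `v` is `u` shifted by one place. As `a ≠ b`, the blocks
do not overlap. -/
theorem value_swap {q : ℝ} (hq : 1 < q) {a b a' b' : Fin 3} (hab : a ≠ b)
    (hdig : digit q b' - digit q b = - q * (digit q a' - digit q a)) {A : Set ℕ} {d : ℕ → Fin 3}
    (hA : ∀ i ∈ A, d i = a ∧ d (i + 1) = b) : value q (swap a' b' A d) = value q d := by
  classical
  set u : ℕ → ℝ := fun i => if i ∈ A then (digit q a' - digit q a) / q ^ (i + 1) else 0 with hu
  set v : ℕ → ℝ := fun i => Nat.casesOn i 0 u with hv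
  have hsum : ∀ i, digit q (swap a' b' A d i) / q ^ (i + 1) =
      digit q (d i) / q ^ (i + 1) + (u i - v i) := by
    intro i
    have hq0 : q ≠ 0 := by positivity
    cases i with
    | zero =>
      by_cases h0 : 0 ∈ A
      · simp [swap, hu, hv, h0, hA 0 h0]; ring
      · simp [swap, hu, hv, h0]
    | succ i =>
      by_cases h0 : i + 1 ∈ A
      · have h1 : i ∉ A := fun h1 => hab ((hA _ h0).1.symm.trans (hA _ h1).2)
        simp [swap, hu, hv, h0, hA _ h0, h1]; ring
      · by_cases h1 : i ∈ A
        · have h2 : digit q b' = digit q b - q * (digit q a' - digit q a) := by linarith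
          simp only [swap, hu, hv, h0, h1, (hA _ h1).2, if_false, if_true, add_left_inj,
            exists_eq_right, h2, pow_succ q (i + 1)]
          field_simp; ring
        · simp [swap, hu, hv, h0, h1]
  have hus : Summable u := by
    refine Summable.of_norm_bounded
      (g := fun i => |digit q a' - digit q a| / q * (q / q ^ (i + 1)))
      ((summable_bound hq).summable.mul_left _) fun i => ?_
    have hq0 : q ≠ 0 := by positivity
    have h1 : |digit q a' - digit q a| / q * (q / q ^ (i + 1)) =
        |digit q a' - digit q a| / q ^ (i + 1) := by field_simp
    rw [h1, hu]
    by_cases h : i ∈ A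
    · simp only [h, if_true, Real.norm_eq_abs, abs_div, abs_of_pos (by positivity : 0 < q ^ (i + 1))]
      exact le_rfl
    · simp only [h, if_false, norm_zero]; positivity
  have hvs : HasSum v (∑' i, u i) := by
    rw [← hasSum_nat_add_iff' 1]
    simpa [hv] using hus.hasSum
  have h := (hasSum_value hq d).add (hus.hasSum.sub hvs)
  rw [sub_self, add_zero] at h
  exact (HasSum.unique (by simpa only [hsum] using h) (hasSum_value hq (swap a' b' A d))).symm

theorem swap_eq_left_iff {a b a' b' : Fin 3} (hab : a ≠ b) (ha : a ≠ a') {A : Set ℕ}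
    {d : ℕ → Fin 3} (hA : ∀ i ∈ A, d i = a ∧ d (i + 1) = b) {i : ℕ} (hi : d i = a) :
    swap a' b' A d i = a' ↔ i ∈ A := by
  classical
  refine ⟨fun h => ?_, fun h => if_pos h⟩
  by_contra hiA
  have h2 : ¬ ∃ j ∈ A, j + 1 = i := by
    rintro ⟨j, hj, rfl⟩
    exact hab (hi.symm.trans (hA j hj).2)
  rw [swap, if_neg hiA, if_neg h2, hi] at h
  exact ha h

theorem not_countable_codes_of_infinite {q : ℝ} (hq : 1 < q) {a b a' b' : Fin 3} (hab : a ≠ b)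
    (ha : a ≠ a') (hdig : digit q b' - digit q b = - q * (digit q a' - digit q a))
    {d : ℕ → Fin 3} (hinf : {i | d i = a ∧ d (i + 1) = b}.Infinite) :
    ¬ (codes q (value q d)).Countable := by
  intro hc
  set f := hinf.natEmbedding
  have hf : ∀ B : Set ℕ, ∀ i ∈ (fun n => (f n : ℕ)) '' B, d i = a ∧ d (i + 1) = b := by
    rintro B _ ⟨n, -, rfl⟩
    exact (f n).2
  set g : Set ℕ → (ℕ → Fin 3) := fun B => swap a' b' ((fun n => (f n : ℕ)) '' B) d with hg
  have hfi : Function.Injective fun n => (f n : ℕ) := Subtype.val_injective.comp f.injective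
  have hginj : Function.Injective g := by
    intro B C h
    have key : ∀ D, ∀ n, g D (f n) = a' ↔ n ∈ D := fun D n => by
      rw [hg, swap_eq_left_iff hab ha (hf D) (f n).2.1]
      exact hfi.mem_set_image
    ext n
    rw [← key B, ← key C, h]
  have h1 : (range g).Countable := hc.mono (by
    rintro _ ⟨B, rfl⟩
    exact value_swap hq hab hdig (hf B))
  rw [← Cardinal.le_aleph0_iff_set_countable, Cardinal.mk_range_eq g hginj, Cardinal.mk_set,
    Cardinal.mk_nat] at h1
  exact absurd h1 (not_le.2 (Cardinal.cantor ℵ₀))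

theorem not_countable_codes_of_noConstTail {q : ℝ} (hq : 1 < q) (hq' : 3 * q - 1 ≤ q ^ 2) {x : ℝ}
    (hinf : (codes q x).Infinite) (hnc : NoConstTail q x) : ¬ (codes q x).Countable := by
  obtain ⟨d, hd, hacc⟩ :=
    hinf.exists_accPt_of_subset_isCompact (isClosed_codes hq x).isCompact subset_rfl
  have hd : value q d = x := hd
  subst hd
  -- An expansion agreeing with the accumulation point `d` up to `N` first differs at some `n ≥ N`.
  -- There `d` reads 02, or else the other expansion does and `d` contains a 10 from `n` on.
  have hbranch : ∀ N, ∃ k ≥ N, (d k = 1 ∧ d (k + 1) = 0) ∨ (d k = 0 ∧ d (k + 1) = 2) := by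
    intro N
    have hnhds : {e : ℕ → Fin 3 | ∀ i < N, e i = d i} ∈ 𝓝 d := by
      have : {e : ℕ → Fin 3 | ∀ i < N, e i = d i} = ⋂ i ∈ Set.Iio N, (fun e => e i) ⁻¹' {d i} := by
        ext; simp
      rw [this, biInter_mem (finite_Iio N)]
      exact fun i _ => (continuous_apply i).continuousAt.preimage_mem_nhds (by simp)
    obtain ⟨e, ⟨heN, he⟩, hne⟩ := accPt_iff_nhds.1 hacc _ hnhds
    have hex : ∃ n, d n ≠ e n := by
      by_contra! h
      exact hne (funext h).symm
    classical
    set n := Nat.find hex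
    have hn : d n ≠ e n := Nat.find_spec hex
    have hlt : ∀ i < n, d i = e i := fun i hi => not_not.1 (Nat.find_min hex hi)
    have hNn : N ≤ n := by
      by_contra! h
      exact hn (heN n h).symm
    have hval : value q (tail n d) = value q (tail n e) :=
      (value_eq_iff_tail hq hlt).1 (show value q e = value q d from he).symm
    have hncn := hnc.tail hq n
    rcases first_digits_of_value_eq hq hq' hval (by simpa using hn) with h | h | h | h
    · exact absurd h (hncn _ rfl 1 0)
    · exact absurd h (hncn _ hval.symm 1 0)
    · refine ⟨n, hNn, Or.inr ⟨?_, ?_⟩⟩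
      · simpa using h.1
      · simpa [add_comm] using h.2.1
    · obtain ⟨k, hk⟩ := exists_one_zero hq hq' hncn hval.symm h.1 h.2.1 h.2.2
      refine ⟨k + n, by omega, Or.inl ⟨hk.1, ?_⟩⟩
      rw [add_right_comm]; exact hk.2
  have hunion : ({k | d k = 1 ∧ d (k + 1) = 0} ∪ {k | d k = 0 ∧ d (k + 1) = 2}).Infinite := by
    refine infinite_of_not_bddAbove ?_
    rintro ⟨N, hN⟩
    obtain ⟨k, hk, hk'⟩ := hbranch (N + 1)
    have := hN hk'
    omega
  rcases infinite_union.1 hunion with h | h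
  · exact not_countable_codes_of_infinite hq (a' := 0) (b' := 2) (by decide) (by decide)
      (by simp) h
  · exact not_countable_codes_of_infinite hq (a' := 1) (b' := 0) (by decide) (by decide)
      (by simp) h

theorem countable_U_of_large {q : ℝ} (hq : 1 < q) (hq' : 3 * q - 1 ≤ q ^ 2) :
    (U q ℵ₀).Countable := by
  have hsub : U q ℵ₀ ⊆ ⋃ l, wordMap q l '' range fun a => value q fun _ => a := by
    intro x hx
    obtain ⟨hc, hi⟩ := (mem_U_aleph0_iff hq).1 hx
    have : ¬ NoConstTail q x := fun h => not_countable_codes_of_noConstTail hq hq' hi h hc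
    simp only [NoConstTail, not_forall, not_not] at this
    obtain ⟨e, rfl, n, a, he⟩ := this
    obtain ⟨l, hl⟩ := exists_wordMap hq n e
    exact mem_iUnion.2 ⟨l, _, ⟨a, rfl⟩, by rw [he] at hl; exact hl⟩
  exact (countable_iUnion fun l => ((countable_range _).image _)).mono hsub

/-! ### The constants -/

theorem qc_eq : (qc - 1) ^ 3 = qc := by linear_combination qc_spec

theorem two_lt_qc : 2 < qc := by
  have h := qc_eq
  by_contra! h2
  rcases le_or_gt qc 1 with h1 | h1
  · nlinarith [pow_two_nonneg (qc - 1), pow_two_nonneg qc, qc_spec,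
      mul_nonneg (sub_nonneg.2 h1) (sq_nonneg (qc - 1)), mul_nonneg (sub_nonneg.2 h1) (sq_nonneg qc)]
  · nlinarith [mul_nonneg (sub_nonneg.2 h2) (sq_nonneg (qc - 1)), mul_pos (sub_pos.2 h1) (sub_pos.2 h1)]

theorem poly_nonpos {q : ℝ} (hq : 1 < q) (h : q ≤ qc) : q ^ 3 - 3 * q ^ 2 + 2 * q - 1 ≤ 0 := by
  have h1 := qc_spec
  have h2 := two_lt_qc
  have h3 : 0 ≤ q ^ 2 + q * qc + qc ^ 2 - 3 * (q + qc) + 2 := by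
    nlinarith [mul_pos (sub_pos.2 hq) (sub_pos.2 h2), mul_pos (sub_pos.2 hq) (sub_pos.2 hq)]
  nlinarith [mul_nonneg (sub_nonneg.2 h) h3]

theorem qstar_sq : qstar ^ 2 = 3 * qstar - 1 := by
  have : √5 ^ 2 = 5 := Real.sq_sqrt (by norm_num)
  rw [qstar]; linear_combination this / 4

theorem two_lt_qstar : 2 < qstar := by
  have : 1 < √5 := by rw [Real.lt_sqrt] <;> norm_num
  rw [qstar]; linarith

theorem qc_lt_qstar : qc < qstar := by
  by_contra! h
  have h2 := two_lt_qstar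
  have h3 := poly_nonpos (by linarith) h
  have h4 := qstar_sq
  nlinarith

theorem sq_le_of_le_qstar {q : ℝ} (hq : 1 < q) (h : q ≤ qstar) : q ^ 2 ≤ 3 * q - 1 := by
  nlinarith [qstar_sq, two_lt_qstar]

theorem le_sq_of_qstar_le {q : ℝ} (h : qstar ≤ q) : 3 * q - 1 ≤ q ^ 2 := by
  nlinarith [qstar_sq, two_lt_qstar]

/-! ### The dimension of the set of points with a unique expansion -/

theorem value_prepend_one_zero {q : ℝ} (hq : 1 < q) {d : ℕ → Fin 3} (h0 : d 0 = 0) (h1 : d 1 = 2) :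
    value q (prepend 1 (prepend 0 (tail 2 d))) = value q d := by
  have e1 := mul_value hq d
  have e2 := mul_value hq (tail 1 d)
  have e3 := value_prepend hq 1 (prepend 0 (tail 2 d))
  have e4 := value_prepend hq 0 (tail 2 d)
  rw [h0, digit_zero] at e1
  rw [tail_tail, tail_apply, zero_add, h1, digit_two] at e2
  rw [digit_one] at e3
  rw [digit_zero] at e4
  norm_num at e2
  refine mul_left_cancel₀ (by positivity : q ≠ 0) (mul_left_cancel₀ (by positivity : q ≠ 0) ?_)
  rw [e3, mul_add, e4, e1]; linarith

theorem IsUnivoque.not_zero_two {q : ℝ} (hq : 1 < q) {d : ℕ → Fin 3} (hd : IsUnivoque q d)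
    (h0 : d 0 = 0) : d 1 ≠ 2 := fun h1 => by
  rw [← hd _ (value_prepend_one_zero hq h0 h1)] at h0
  simp at h0

theorem IsUnivoque.not_one_zero {q : ℝ} (hq : 1 < q) {d : ℕ → Fin 3} (hd : IsUnivoque q d)
    (h0 : d 0 = 1) : d 1 ≠ 0 := fun h1 => by
  have h := value_prepend_one_zero hq (d := prepend 0 (prepend 2 (tail 2 d))) rfl rfl
  have h2 : prepend 1 (prepend 0 (tail 2 (prepend 0 (prepend 2 (tail 2 d))))) = d := by
    funext i
    match i with
    | 0 => exact h0.symm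
    | 1 => exact h1.symm
    | i + 2 => rfl
  rw [h2] at h
  rw [← hd _ h.symm] at h0
  simp at h0

/-- The letters that may follow a given letter in a univoque sequence. -/
def followers : Fin 3 → Finset (Fin 3) := ![{0, 1}, {1, 2}, {0, 1, 2}]

theorem IsUnivoque.mem_followers {q : ℝ} (hq : 1 < q) {d : ℕ → Fin 3} (hd : IsUnivoque q d) :
    d 1 ∈ followers (d 0) := by
  rcases fin_three_cases (d 0) with h | h | h <;>
    rcases fin_three_cases (d 1) with h' | h' | h'
  · simp [h, h', followers]
  · simp [h, h', followers]
  · exact absurd h' (hd.not_zero_two hq h)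
  · exact absurd h' (hd.not_one_zero hq h)
  all_goals simp [h, h', followers]

open Classical in
/-- The left endpoints of intervals of length `top q / q ^ n` that cover the values of the univoque
sequences with a given first letter. -/
noncomputable def centers (q : ℝ) : ℕ → Fin 3 → Finset ℝ
  | 0, _ => {0}
  | n + 1, a => (followers a).biUnion fun b => (centers q n b).image fun y => (digit q a + y) / q

theorem exists_center {q : ℝ} (hq : 1 < q) (n : ℕ) {d : ℕ → Fin 3} (hd : IsUnivoque q d) :
    ∃ c ∈ centers q n (d 0), value q d ∈ Icc c (c + top q / q ^ n) := by
  classical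
  induction n generalizing d with
  | zero => exact ⟨0, by simp [centers], value_nonneg hq d, by simpa using value_le_top hq d⟩
  | succ n ih =>
    obtain ⟨c, hc, h1, h2⟩ := ih (hd.tail_one hq)
    have h := mul_value hq d
    refine ⟨(digit q (d 0) + c) / q, ?_, ?_, ?_⟩
    · rw [centers]
      exact Finset.mem_biUnion.2 ⟨_, hd.mem_followers hq, Finset.mem_image_of_mem _ hc⟩
    · rw [div_le_iff₀ (by linarith)]; linarith
    · have h3 : (digit q (d 0) + c) / q + top q / q ^ (n + 1) =
          (digit q (d 0) + (c + top q / q ^ n)) / q := by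
        rw [pow_succ]; field_simp; ring
      rw [h3, le_div_iff₀ (by linarith)]; linarith

/-- The weights 1, `qc - 1`, `(qc - 1) ^ 2` form an eigenvector of the transition matrix `followers`
with eigenvalue `qc`; the last row is the equation `qc_eq`. -/
theorem card_centers (q : ℝ) (n : ℕ) (a : Fin 3) :
    ((centers q n a).card : ℝ) ≤ (qc - 1) ^ (a : ℕ) * qc ^ n := by
  classical
  have h2 := two_lt_qc
  induction n generalizing a with
  | zero => simpa [centers] using one_le_pow₀ (by linarith)
  | succ n ih =>
    have h1 : ((centers q (n + 1) a).card : ℝ) ≤ ∑ b ∈ followers a, ((centers q n b).card : ℝ) := by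
      rw [centers]
      exact_mod_cast Finset.card_biUnion_le.trans
        (Finset.sum_le_sum fun b _ => Finset.card_image_le)
    refine h1.trans ((Finset.sum_le_sum fun b _ => ih b).trans (le_of_eq ?_))
    have h3 := qc_eq
    rw [← Finset.sum_mul, pow_succ]
    rcases fin_three_cases a with rfl | rfl | rfl
    · simp [followers]; ring
    · simp [followers]; ring
    · simp [followers]; linear_combination - qc ^ n * h3

theorem dimH_univoque_le {q : ℝ} (hq : 1 < q) :
    dimH (value q '' {d | IsUnivoque q d}) ≤ ENNReal.ofReal (Real.log qc / Real.log q) := by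
  have hqc := two_lt_qc
  have hq0 : 0 < q := by linarith
  set s := Real.log qc / Real.log q with hs
  have hs0 : 0 ≤ s := div_nonneg (Real.log_nonneg (by linarith)) (Real.log_nonneg hq.le)
  have hqs : q ^ s = qc := by
    rw [hs, Real.rpow_def_of_pos hq0, mul_div_cancel₀ _ (Real.log_pos hq).ne',
      Real.exp_log (by linarith)]
  set W : ℝ := ∑ a : Fin 3, (qc - 1) ^ (a : ℕ) with hW
  have hW0 : 0 ≤ W := Finset.sum_nonneg fun a _ => pow_nonneg (by linarith) _
  have hr : Tendsto (fun n : ℕ => ENNReal.ofReal (top q / q ^ n)) atTop (𝓝 0) := by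
    have := (tendsto_pow_atTop_nhds_zero_of_lt_one (r := q⁻¹) (by positivity)
      (inv_lt_one_of_one_lt₀ hq)).const_mul (top q)
    rw [mul_zero] at this
    simpa [div_eq_mul_inv] using ENNReal.tendsto_ofReal this
  have hbound := MeasureTheory.Measure.hausdorffMeasure_le_liminf_sum
    (ι := fun n => Σ a, centers q n a) s (value q '' {d | IsUnivoque q d})
    (fun n : ℕ => ENNReal.ofReal (top q / q ^ n)) hr
    (fun n i => Icc (i.2 : ℝ) (i.2 + top q / q ^ n))
    (Eventually.of_forall fun n i => by simp [Real.ediam_Icc])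
    (Eventually.of_forall fun n => by
      rintro _ ⟨d, hd, rfl⟩
      obtain ⟨c, hc, h⟩ := exists_center hq n hd
      exact mem_iUnion.2 ⟨⟨d 0, c, hc⟩, h⟩)
  -- With `q ^ s = qc` the number of intervals and their size to the power `s` balance, uniformly in
  -- `n`.
  have hsum : ∀ n : ℕ, ∑ i : Σ a, centers q n a,
      Metric.ediam (Icc (i.2 : ℝ) (i.2 + top q / q ^ n)) ^ s ≤ ENNReal.ofReal (W * top q ^ s) := by
    intro n
    have ht := top_pos hq
    have h1 : (top q / q ^ n) ^ s = top q ^ s / qc ^ n := by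
      rw [Real.div_rpow ht.le (by positivity), ← Real.rpow_natCast, ← Real.rpow_mul hq0.le,
        mul_comm, Real.rpow_mul hq0.le, hqs, Real.rpow_natCast]
    simp only [Real.ediam_Icc, add_sub_cancel_left]
    rw [ENNReal.ofReal_rpow_of_nonneg (by positivity) hs0, h1, Finset.sum_const, nsmul_eq_mul,
      Finset.card_univ, Fintype.card_sigma, ← ENNReal.ofReal_natCast,
      ← ENNReal.ofReal_mul (by positivity)]
    refine ENNReal.ofReal_le_ofReal ?_
    have h2 : ((∑ a : Fin 3, Fintype.card (centers q n a) : ℕ) : ℝ) ≤ W * qc ^ n := by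
      rw [hW, Finset.sum_mul]; push_cast
      exact Finset.sum_le_sum fun a _ => by simpa using card_centers q n a
    calc _ ≤ W * qc ^ n * (top q ^ s / qc ^ n) :=
          mul_le_mul_of_nonneg_right h2 (by positivity)
      _ = W * top q ^ s := by field_simp
  have hfin : μH[s] (value q '' {d | IsUnivoque q d}) ≤ ENNReal.ofReal (W * top q ^ s) :=
    hbound.trans ((liminf_le_liminf (Eventually.of_forall hsum)).trans (by simp))
  refine dimH_le_of_hausdorffMeasure_ne_top (d := s.toNNReal) ?_
  rw [Real.coe_toNNReal _ hs0]
  exact ne_top_of_le_ne_top ENNReal.ofReal_ne_top hfin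

/-! ### The dimension of the set of all expandable points -/

theorem dimH_Icc_top {q : ℝ} (hq : 1 < q) : dimH (Icc 0 (top q)) = 1 := by
  rw [Real.dimH_of_nonempty_interior, Module.finrank_self, Nat.cast_one]
  rw [interior_Icc]
  exact nonempty_Ioo.2 (top_pos hq)

/-- Points this close in base `q` have expansions agreeing in `n` letters once suitable words 02 are
rewritten as 10, which preserves the value in every base. Any other disagreement leaves a gap of at
least `δ`. -/
theorem abs_sub_value_le {p q δ : ℝ} (hp : 1 < p) (hq : 1 < q) (hδ : 0 < δ)
    (hδq : q ^ 2 * δ ≤ q - 1 - top q) (n : ℕ) (d e : ℕ → Fin 3)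
    (h : |value q d - value q e| * q ^ n ≤ δ) : |value p d - value p e| * p ^ n ≤ top p := by
  induction n generalizing d e with
  | zero =>
    rw [pow_zero, mul_one, abs_le]
    constructor <;>
      linarith [value_nonneg hp d, value_nonneg hp e, value_le_top hp d, value_le_top hp e]
  | succ n ih =>
    have same : ∀ d e : ℕ → Fin 3, d 0 = e 0 → |value q d - value q e| * q ^ (n + 1) ≤ δ →
        |value p d - value p e| * p ^ (n + 1) ≤ top p := by
      intro d e h0 h
      have key : ∀ r, 1 < r → |value r d - value r e| * r ^ (n + 1) =
          |value r (tail 1 d) - value r (tail 1 e)| * r ^ n := fun r hr => by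
        have h1 := mul_value hr d
        have h2 := mul_value hr e
        have h3 : value r (tail 1 d) - value r (tail 1 e) = r * (value r d - value r e) := by
          rw [h0] at h1; linarith
        rw [h3, abs_mul, abs_of_pos (by linarith : 0 < r)]; ring
      rw [key q hq] at h
      rw [key p hp]
      exact ih _ _ h
    have far : ∀ d e : ℕ → Fin 3, q ^ 2 * δ ≤ q ^ 2 * (value q e - value q d) →
        ¬ |value q d - value q e| * q ^ (n + 1) ≤ δ := by
      intro d e h
      have h1 : δ ≤ |value q d - value q e| := by
        rw [abs_sub_comm]
        exact (le_of_mul_le_mul_left h (by positivity)).trans (le_abs_self _)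
      have h2 : 1 < q ^ (n + 1) := one_lt_pow₀ hq (by omega)
      nlinarith
    have hqt := top_pos hq
    have far_two : ∀ d e : ℕ → Fin 3, d 0 ≠ 2 → e 0 = 2 →
        q ^ 2 * δ ≤ q ^ 2 * (value q e - value q d) := by
      intro d e hd he
      have h1 := mul_value hq d
      have h2 := mul_value hq e
      rw [he, digit_two] at h2
      have h3 := value_nonneg hq (tail 1 e)
      have h4 := value_le_top hq (tail 1 d)
      have h5 : digit q (d 0) ≤ 1 := by
        rcases fin_three_cases (d 0) with h | h | h
        · simp [h]
        · simp [h]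
        · exact absurd h hd
      have h6 : q - 1 - top q ≤ q * (value q e - value q d) := by linarith
      have h7 : 0 ≤ q * (value q e - value q d) := by nlinarith
      nlinarith
    have zero_one : ∀ d e : ℕ → Fin 3, d 0 = 0 → e 0 = 1 →
        |value q d - value q e| * q ^ (n + 1) ≤ δ →
        |value p d - value p e| * p ^ (n + 1) ≤ top p := by
      intro d e hd he h
      by_cases hd1 : d 1 = 2
      · rw [← value_prepend_one_zero hq hd hd1] at h
        rw [← value_prepend_one_zero hp hd hd1]
        exact same _ _ he.symm h
      · refine absurd h (far d e ?_)
        have h1 := mul_value hq d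
        have h2 := mul_value hq e
        have h3 := mul_value hq (tail 1 d)
        rw [he, digit_one] at h2
        rw [hd, digit_zero] at h1
        have h4 := value_nonneg hq (tail 1 e)
        have h5 := value_le_top hq (tail 1 (tail 1 d))
        have h6 : digit q (tail 1 d 0) ≤ 1 := by
          rcases fin_three_cases (d 1) with h | h | h
          · simp [h]
          · simp [h]
          · exact absurd h hd1
        nlinarith
    rcases eq_or_ne (d 0) (e 0) with h0 | h0
    · exact same d e h0 h
    by_cases hd2 : d 0 = 2
    · rw [abs_sub_comm] at h
      exact absurd h (far e d (far_two e d (fun h => h0 (hd2.trans h.symm)) hd2))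
    by_cases he2 : e 0 = 2
    · exact absurd h (far d e (far_two d e hd2 he2))
    rcases fin_three_cases (d 0) with hd | hd | hd <;>
      rcases fin_three_cases (e 0) with he | he | he <;>
      first
      | exact zero_one d e hd he h
      | (rw [abs_sub_comm] at h ⊢; exact zero_one e d he hd h)
      | exact absurd (hd.trans he.symm) h0
      | exact absurd hd hd2
      | exact absurd he he2

/-- Rereading an expansion in base `qstar` gives a map from `E q` onto an interval that is Hölder of
exponent `s`. -/
theorem le_dimH_E {q : ℝ} (hq : qstar < q) :
    ENNReal.ofReal (Real.log qstar / Real.log q) ≤ dimH (E q) := by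
  set p := qstar with hpdef
  have hp : 1 < p := by linarith [two_lt_qstar]
  have hq1 : 1 < q := hp.trans hq
  have hp0 : 0 < p := by linarith
  have hq0 : 0 < q := by linarith
  set s := Real.log p / Real.log q with hs
  have hs0 : 0 < s := div_pos (Real.log_pos hp) (Real.log_pos hq1)
  have hqs : q ^ s = p := by
    rw [hs, Real.rpow_def_of_pos hq0, mul_div_cancel₀ _ (Real.log_pos hq1).ne', Real.exp_log hp0]
  have htop : 0 < q - 1 - top q := by
    have h1 : 3 * q - 1 < q ^ 2 := by nlinarith [qstar_sq, two_lt_qstar]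
    have h2 : top q < q - 1 := by
      rw [top, div_lt_iff₀ (by linarith)]; nlinarith
    linarith
  obtain ⟨δ, hδ, hδq⟩ : ∃ δ > 0, q ^ 2 * δ ≤ q - 1 - top q :=
    ⟨(q - 1 - top q) / q ^ 2, by positivity, by rw [mul_div_cancel₀ _ (by positivity)]⟩
  have hexp : ∀ x ∈ E q, ∃ d, value q d = x := fun x hx => (mem_E_iff hq1).1 hx
  choose! c hc using hexp
  set g : ℝ → ℝ := fun x => value p (c x) with hg
  have hsurj : g '' E q = Icc 0 (top p) := by
    rw [← E_eq_Icc hp qstar_sq.le]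
    ext z
    rw [mem_E_iff hp]
    constructor
    · rintro ⟨x, -, rfl⟩
      exact ⟨c x, rfl⟩
    · rintro ⟨d, rfl⟩
      have hx : value q d ∈ E q := (mem_E_iff hq1).2 ⟨d, rfl⟩
      -- The choice of expansion is immaterial: equal values in base `q` satisfy the hypothesis of
      -- `abs_sub_value_le` for all `n`, so the values in base `p` agree too.
      refine ⟨value q d, hx, ?_⟩
      by_contra hne
      have hpos : 0 < |g (value q d) - value p d| := abs_pos.2 (sub_ne_zero.2 hne)
      obtain ⟨n, hn⟩ := pow_unbounded_of_one_lt (top p / |g (value q d) - value p d|) hp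
      rw [div_lt_iff₀ hpos] at hn
      have := abs_sub_value_le hp hq1 hδ hδq n (c (value q d)) d (by
        rw [hc _ hx, sub_self, abs_zero, zero_mul]; exact hδ.le)
      rw [mul_comm] at this
      linarith
  have htp := top_pos hp
  have hdist : ∀ x ∈ E q, ∀ y ∈ E q, |g x - g y| ≤ top p * p / δ ^ s * |x - y| ^ s := by
    intro x hx y hy
    have hδs : 0 < δ ^ s := Real.rpow_pos_of_pos hδ s
    rcases eq_or_ne x y with rfl | hxy
    · rw [sub_self, abs_zero]; positivity
    have hpos : 0 < |x - y| := abs_pos.2 (sub_ne_zero.2 hxy)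
    have hfin : ∀ n : ℕ, |x - y| * q ^ n ≤ δ → δ ≤ |x - y| * q ^ (n + 1) →
        |g x - g y| ≤ top p * p / δ ^ s * |x - y| ^ s := by
      intro n h1 h2
      have h3 := abs_sub_value_le hp hq1 hδ hδq n (c x) (c y) (by rw [hc x hx, hc y hy]; exact h1)
      have h4 := Real.rpow_le_rpow hδ.le h2 hs0.le
      rw [Real.mul_rpow hpos.le (by positivity), ← Real.rpow_natCast q, ← Real.rpow_mul hq0.le,
        mul_comm ((n + 1 : ℕ) : ℝ), Real.rpow_mul hq0.le, hqs, Real.rpow_natCast] at h4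
      have h5 : |g x - g y| ≤ top p / p ^ n := (le_div_iff₀ (by positivity)).2 h3
      refine h5.trans ?_
      rw [div_mul_eq_mul_div, div_le_div_iff₀ (by positivity) hδs]
      rw [pow_succ] at h4
      calc top p * δ ^ s ≤ top p * (|x - y| ^ s * (p ^ n * p)) :=
            mul_le_mul_of_nonneg_left h4 htp.le
        _ = _ := by ring
    rcases le_total |x - y| δ with h | h
    -- Take the largest `n` with `|x - y| * q ^ n ≤ δ`, so that `p ^ (-n)` is comparable to `|x - y|
    -- ^ s`.
    · obtain ⟨n, h1, h2⟩ := exists_nat_pow_near ((one_le_div hpos).2 h) hq1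
      rw [le_div_iff₀ hpos] at h1
      rw [div_lt_iff₀ hpos] at h2
      exact hfin n (by linarith) (by linarith)
    · have h1 : |g x - g y| ≤ top p := by
        rw [abs_le]
        constructor <;> linarith [value_nonneg hp (c x), value_nonneg hp (c y),
          value_le_top hp (c x), value_le_top hp (c y)]
      have h4 := Real.rpow_le_rpow hδ.le h hs0.le
      refine h1.trans ?_
      rw [div_mul_eq_mul_div, le_div_iff₀ hδs]
      have h5 := mul_le_mul_of_nonneg_left h4 htp.le
      have h6 : 0 ≤ top p * |x - y| ^ s := by positivity
      nlinarith
  have hC : 0 ≤ top p * p / δ ^ s := by positivity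
  have hholder : HolderOnWith (top p * p / δ ^ s).toNNReal s.toNNReal g (E q) := by
    intro x hx y hy
    rw [edist_dist, edist_dist, Real.dist_eq, Real.dist_eq, Real.coe_toNNReal _ hs0.le,
      ENNReal.ofReal_rpow_of_nonneg (abs_nonneg _) hs0.le]
    change _ ≤ ENNReal.ofReal _ * _
    rw [← ENNReal.ofReal_mul hC]
    exact ENNReal.ofReal_le_ofReal (hdist x hx y hy)
  have h1 := hholder.dimH_image_le (Real.toNNReal_pos.2 hs0)
  rw [hsurj, dimH_Icc_top hp] at h1
  have h2 : ((s.toNNReal : ℝ≥0) : ℝ≥0∞) ≠ 0 := by simpa using hs0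
  rw [ENNReal.le_div_iff_mul_le (Or.inl h2) (Or.inl ENNReal.coe_ne_top), one_mul] at h1
  exact h1

theorem dimH_univoque_lt_dimH_E {q : ℝ} (hq : 1 < q) :
    dimH (value q '' {d | IsUnivoque q d}) < dimH (E q) := by
  have hqc := two_lt_qc
  rcases le_or_gt q qstar with h | h
  · rw [E_eq_Icc hq (sq_le_of_le_qstar hq h), dimH_Icc_top hq]
    rcases le_or_gt q qc with h' | h'
    · have hsub : value q '' {d | IsUnivoque q d} ⊆ value q '' {fun _ => 0, fun _ => 2} :=
        image_mono fun d hd => IsUnivoque.eq_const hq (poly_nonpos hq h') hd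
      rw [dimH_countable (((toFinite _).countable.image _).mono hsub)]
      exact zero_lt_one
    · refine (dimH_univoque_le hq).trans_lt ?_
      rw [ENNReal.ofReal_lt_one, div_lt_one (Real.log_pos hq)]
      exact Real.log_lt_log (by linarith) h'
  · refine (dimH_univoque_le hq).trans_lt (lt_of_lt_of_le ?_ (le_dimH_E h))
    have h1 := Real.log_pos hq
    have h2 : 0 < Real.log qstar := Real.log_pos (by linarith [two_lt_qstar])
    rw [ENNReal.ofReal_lt_ofReal_iff (div_pos h2 h1), div_lt_div_iff_of_pos_right h1]
    exact Real.log_lt_log (by linarith) qc_lt_qstar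

theorem dimH_U_continuum {q : ℝ} (hq : 1 < q) : dimH (U q (2 ^ ℵ₀)) = dimH (E q) := by
  refine le_antisymm (dimH_mono fun x hx => hx.1) ?_
  have hsub : E q ⊆ U q (2 ^ ℵ₀) ∪ ⋃ l, wordMap q l '' (value q '' {d | IsUnivoque q d}) := by
    intro x hx
    by_cases hc : (codes q x).Countable
    · obtain ⟨l, d, hd, hl⟩ := exists_wordMap_univoque hq ((mem_E_iff hq).1 hx) hc
      exact Or.inr (mem_iUnion.2 ⟨l, _, ⟨d, hd, rfl⟩, hl⟩)
    · exact Or.inl (mem_U_continuum hq hc)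
  have h1 := dimH_mono hsub
  rw [dimH_union, dimH_iUnion, le_max_iff] at h1
  refine h1.resolve_right fun h => ?_
  exact absurd (h.trans (iSup_le fun l => (lipschitz_wordMap hq l).dimH_image_le _))
    (not_le.2 (dimH_univoque_lt_dimH_E hq))

end QExpansion

theorem theorem1p4 :
    (∀ q ∈ QExpansion.B ℵ₀ \ Set.Ioo QExpansion.qc QExpansion.qstar,
      #(QExpansion.U q ℵ₀) = ℵ₀) ∧
    (∀ q : ℝ, 1 < q → dimH (QExpansion.U q (2 ^ ℵ₀)) = dimH (QExpansion.E q)) := by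
  refine ⟨?_, fun q hq => QExpansion.dimH_U_continuum hq⟩
  rintro q ⟨⟨hq, x, hx⟩, hne⟩
  refine QExpansion.mk_eq_aleph0_iff.2 ⟨?_, QExpansion.infinite_U hq (x := x) hx⟩
  rcases le_or_gt q QExpansion.qc with h | h
  · exact QExpansion.countable_U_of_small hq (QExpansion.poly_nonpos hq h)
  · exact QExpansion.countable_U_of_large hq
      (QExpansion.le_sq_of_qstar_le (not_lt.1 fun h' => hne ⟨h, h'⟩))
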